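/- Conventions. A pure state of $N$ parties is a vector in $(\mathbb C^{\kappa})^{\otimes N}$. For $N$-partite states $|\psi\rangle,|\phi\rangle$ write $|\psi\rangle\to|\phi\rangle$ (convertibility by SLOCC) if there are linear operators $A_1,\dots,A_N$ on the local spaces and a scalar $c\neq 0$ with $(A_1\otimes\cdots\otimes A_N)|\psi\rangle=c\,|\phi\rangle$. The state $|\psi\rangle^{\otimes n}$ is regarded as $N$-partite, the $i$-th party holding the $i$-th subsystem of each copy. Put $$R(|\psi\rangle,|\phi\rangle)=\sup\Big\{\frac mn : m\ge 0,\ n\geq 1,\ |\psi\rangle^{\otimes n}\to|\phi\rangle^{\otimes m}\Big\}\in[0,\infty].$$ Let $|GHZ\rangle_N=\tfrac1{\sqrt2}(|0\cdots0\rangle+|1\cdots1\rangle)$. For integers $j_1,\dots,j_d\ge 1$ with $N=\sum_{i=1}^d j_i$, the $N$-partite Dicke state $|D(j_1,\dots,j_d)\rangle$ is the normalization of $P_{\mathrm{sym}}\big(|1\rangle^{\otimes j_1}\otimes\cdots\otimes|d\rangle^{\otimes j_d}\big)$, where $P_{\mathrm{sym}}=\frac1{N!}\sum_{\pi\in S_N}U_\pi$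 is the projection onto the fully symmetric subspace of $(\mathbb C^d)^{\otimes N}$. Theorem 2. Let $d\ge1$, let $j_1\ge\cdots\ge j_d\ge1$ be integers and $N=\sum_{i=1}^d j_i$. Then, with the convention $0^{-1}=\infty$ (which only matters for $d=1$): 1. $$R\big(|GHZ\rangle_N,|D(j_1,\dots,j_d)\rangle\big)\ \ge\ \Big(\sum_{i=2}^d\log_2(j_i+1)\Big)^{-1}.$$ 2. For all integers $m,n\ge0$ with $2^m\ge\prod_{k=2}^d\binom{nj_k+N-1}{N-1}(j_k+1)^n$, one has $|GHZ\rangle_N^{\otimes m}\to|D(j_1,\dots,j_d)\rangle^{\otimes n}$. 3. If $j_1\ge\sum_{i=2}^d j_i$, then equality holds in 1. -/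

import Mathlib

open scoped ENNReal

namespace SLOCC

/-- A (not necessarily normalized) pure state of `N` parties, each holding a system with
computational basis indexed by `κ`, given by its amplitudes in the product basis: `ψ x` is the
coefficient of `|x 0⟩ ⊗ ⋯ ⊗ |x (N-1)⟩`. -/
abbrev State (N : ℕ) (κ : Type) : Type := (Fin N → κ) → ℂ

/-- The product basis state `|x 0⟩ ⊗ ⋯ ⊗ |x (N-1)⟩`. -/
def ket {N : ℕ} {κ : Type} [DecidableEq κ] (x : Fin N → κ) : State N κ := Pi.single x 1

/-- `n` copies of `ψ`, as an `N`-partite state: party `i` holds the `i`-th subsystem of every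
copy, so that its computational basis is indexed by `Fin n → κ`. -/
def copies {N : ℕ} {κ : Type} (ψ : State N κ) (n : ℕ) : State N (Fin n → κ) :=
  fun x => ∏ k, ψ (fun i => x i k)

/-- The action of the product operator `A 0 ⊗ ⋯ ⊗ A (N-1)` on a state. -/
def applyLocal {N : ℕ} {κ κ' : Type} [Fintype κ] (A : Fin N → Matrix κ' κ ℂ) (ψ : State N κ) :
    State N κ' :=
  fun y => ∑ x, (∏ i, A i (y i) (x i)) * ψ x

/-- `ψ` can be transformed to `φ` by SLOCC: some product of local operators maps `ψ` to `φ`, up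
to a nonzero normalization factor. -/
def Transforms {N : ℕ} {κ κ' : Type} [Fintype κ] (ψ : State N κ) (φ : State N κ') : Prop :=
  ∃ (A : Fin N → Matrix κ' κ ℂ) (c : ℂ), c ≠ 0 ∧ applyLocal A ψ = c • φ

/-- The SLOCC entanglement transformation rate `sup {m / n : ψ^{⊗ n} → φ^{⊗ m}}`, as an element
of `[0, ∞]`. -/
noncomputable def rate {N : ℕ} {κ κ' : Type} [Fintype κ] (ψ : State N κ) (φ : State N κ') :
    ℝ≥0∞ :=
  sSup {r | ∃ m n : ℕ, 0 < n ∧ Transforms (copies ψ n) (copies φ m) ∧ r = (m : ℝ≥0∞) / n}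

/-- The `N`-partite GHZ state `(|0⋯0⟩ + |1⋯1⟩) / √2`. -/
noncomputable def ghz (N : ℕ) : State N (Fin 2) :=
  ((Real.sqrt 2 : ℝ) : ℂ)⁻¹ • (ket (fun _ => 0) + ket (fun _ => 1))

/-- The projection `(1 / N!) ∑_π U_π` onto the fully symmetric subspace. -/
noncomputable def symProj {N : ℕ} {κ : Type} (ψ : State N κ) : State N κ :=
  fun x => (Nat.factorial N : ℂ)⁻¹ * ∑ π : Equiv.Perm (Fin N), ψ (fun i => x (π i))

/-- The word consisting of `j 0` letters `0`, then `j 1` letters `1`, and so on. -/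
def blockWord {d : ℕ} (j : Fin d → ℕ) : Fin (∑ i, j i) → Fin d :=
  fun p => (finSigmaFinEquiv.symm p).1

/-- The normalized Dicke state `|D(j 0, …, j (d-1))⟩`, of `N = ∑ i, j i` parties. The projected
product state has norm `(N choose j 0, …, j (d-1))^{-1/2}`, whence the prefactor. -/
noncomputable def dicke {d : ℕ} (j : Fin d → ℕ) : State (∑ i, j i) (Fin d) :=
  ((Real.sqrt (Nat.multinomial Finset.univ j) : ℝ) : ℂ) • symProj (ket (blockWord j))

end SLOCC

/-!
Up to a scalar, `m` copies of the GHZ state form one GHZ state with `2 ^ m` levels, so they can be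
transformed into `φ` iff `φ` has tensor rank at most `2 ^ m`.

Up to a scalar, the Dicke state is the indicator of the words in which each letter `k` occurs `j k`
times. As the length of the word is fixed, this is the product of the indicators of these conditions
for all letters but one. For `n` copies and a single letter, the condition that its count is `s` in
every copy is equivalent to the congruences modulo `s + 1` in every copy together with the total
count being `n * s`. Each congruence costs a factor `s + 1` in tensor rank, by expansion in the
characters of `ℤ / (s + 1)`, while the condition on the total costs only the number of ways of
distributing `n * s` among the parties, which is polynomial in `n`.

Conversely, the tensor rank is at least the rank of a flattening. Splitting the parties into `S` and
its complement, the Dicke state correlates the letter counts on the two sides perfectly, so its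
flattening contains an identity matrix indexed by the letter counts `a ≤ j` with sum `#S`. When one
letter occurs at least as often as all others together, taking `#S` to be the number of the other
letters leaves their counts on `S` arbitrary.
-/

namespace SLOCC

open Finset Filter Topology

variable {N : ℕ} {κ κ' ι : Type}

/-! ### Product states and tensor rank -/

/-- The product state `v 0 ⊗ ⋯ ⊗ v (N-1)`. -/
def productState (v : Fin N → κ → ℂ) : State N κ := fun x => ∏ i, v i (x i)

theorem productState_mul (v w : Fin N → κ → ℂ) :
    productState (v * w) = productState v * productState w :=
  funext fun _ => prod_mul_distrib

theorem productState_one : productState (1 : Fin N → κ → ℂ) = 1 :=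
  funext fun _ => prod_const_one

/-- `TensorRankLE φ r` says that the tensor rank of `φ` is at most `r`: it is a combination of
`r` product states. The weights `w` are explicit so that no party has to be singled out. -/
def TensorRankLE (φ : State N κ) (r : ℕ) : Prop :=
  ∃ (w : Fin r → ℂ) (v : Fin r → Fin N → κ → ℂ), φ = ∑ t, w t • productState (v t)

theorem TensorRankLE.of_card_le {T : Type*} [Fintype T] {φ : State N κ} {r : ℕ}
    (hr : Fintype.card T ≤ r) {w : T → ℂ} {v : T → Fin N → κ → ℂ}
    (hφ : φ = ∑ t, w t • productState (v t)) : TensorRankLE φ r := by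
  obtain ⟨e⟩ : Nonempty (T ↪ Fin r) := Function.Embedding.nonempty_of_card_le (by simpa using hr)
  refine ⟨Function.extend e w 0, Function.extend e v 0, hφ.trans ?_⟩
  refine Fintype.sum_of_injective e e.injective _ _ (fun t ht => ?_) fun t => ?_
  · rw [Function.extend_apply' _ _ _ ht, Pi.zero_apply, zero_smul]
  · rw [e.injective.extend_apply, e.injective.extend_apply]

theorem TensorRankLE.mono {φ : State N κ} {r s : ℕ} (h : TensorRankLE φ r) (hrs : r ≤ s) :
    TensorRankLE φ s :=
  let ⟨_, _, hφ⟩ := h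
  .of_card_le (by simpa using hrs) hφ

theorem TensorRankLE.smul {φ : State N κ} {r : ℕ} (h : TensorRankLE φ r) (c : ℂ) :
    TensorRankLE (c • φ) r := by
  obtain ⟨w, v, rfl⟩ := h
  exact ⟨c • w, v, by simp only [smul_sum, smul_smul, Pi.smul_apply, smul_eq_mul]⟩

theorem tensorRankLE_smul_iff {φ : State N κ} {r : ℕ} {c : ℂ} (hc : c ≠ 0) :
    TensorRankLE (c • φ) r ↔ TensorRankLE φ r :=
  ⟨fun h => by simpa only [inv_smul_smul₀ hc] using h.smul c⁻¹, fun h => h.smul c⟩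

theorem tensorRankLE_one : TensorRankLE (1 : State N κ) 1 :=
  ⟨1, 1, by simp [productState_one]⟩

theorem TensorRankLE.mul {φ ψ : State N κ} {r s : ℕ} (hφ : TensorRankLE φ r)
    (hψ : TensorRankLE ψ s) : TensorRankLE (φ * ψ) (r * s) := by
  obtain ⟨w, v, rfl⟩ := hφ
  obtain ⟨w', v', rfl⟩ := hψ
  refine .of_card_le (T := Fin r × Fin s) (by simp) (w := fun t => w t.1 * w' t.2)
    (v := fun t => v t.1 * v' t.2) ?_
  simp only [sum_mul_sum, smul_mul_smul_comm, productState_mul, Fintype.sum_prod_type]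

theorem TensorRankLE.prod {T : Type*} (s : Finset T) {φ : T → State N κ} {r : T → ℕ}
    (h : ∀ t ∈ s, TensorRankLE (φ t) (r t)) : TensorRankLE (∏ t ∈ s, φ t) (∏ t ∈ s, r t) := by
  induction s using Finset.cons_induction with
  | empty => simpa only [prod_empty] using tensorRankLE_one
  | cons a s ha ih =>
    rw [prod_cons, prod_cons]
    exact (h a (mem_cons_self a s)).mul (ih fun t ht => h t (mem_cons_of_mem ht))

/-! ### SLOCC transformations of GHZ states -/

/-- The unnormalized GHZ state with one level for each element of `ι`. -/
def unitTensor (N : ℕ) (ι : Type) [Fintype ι] [DecidableEq ι] : State N ι :=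
  ∑ b, ket fun _ => b

theorem applyLocal_unitTensor [Fintype ι] [DecidableEq ι] (A : Fin N → Matrix κ ι ℂ) :
    applyLocal A (unitTensor N ι) = ∑ b, productState fun i y => A i y b := by
  funext y
  simp only [applyLocal, unitTensor, ket, productState, Finset.sum_apply, Pi.single_apply, mul_sum]
  rw [sum_comm]
  simp only [mul_ite, mul_one, mul_zero, sum_ite_eq', mem_univ, if_true]

theorem transforms_unitTensor_iff [Fintype ι] [DecidableEq ι] (hN : 0 < N) {φ : State N κ} :
    Transforms (unitTensor N ι) φ ↔ TensorRankLE φ (Fintype.card ι) := by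
  constructor
  · rintro ⟨A, c, hc, hA⟩
    rw [← tensorRankLE_smul_iff hc, ← hA, applyLocal_unitTensor]
    exact .of_card_le le_rfl (w := 1) (by simp only [Pi.one_apply, one_smul]; rfl)
  · rintro ⟨w, v, hφ⟩
    let e := Fintype.equivFin ι
    refine ⟨fun i => .of fun y b => (if i = ⟨0, hN⟩ then w (e b) else 1) * v (e b) i y, 1,
      one_ne_zero, ?_⟩
    rw [applyLocal_unitTensor, one_smul, hφ, ← e.sum_comp]
    refine sum_congr rfl fun b _ => funext fun y => ?_
    simp only [productState, Matrix.of_apply, prod_mul_distrib, prod_ite_eq', mem_univ, if_true,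
      Pi.smul_apply, smul_eq_mul]

theorem copies_smul (c : ℂ) (ψ : State N κ) (n : ℕ) : copies (c • ψ) n = c ^ n • copies ψ n := by
  funext x
  simp [copies, prod_mul_distrib]

theorem copies_unitTensor [Fintype ι] [DecidableEq ι] (n : ℕ) :
    copies (unitTensor N ι) n = unitTensor N (Fin n → ι) := by
  funext x
  simp only [copies, unitTensor, ket, Finset.sum_apply, Pi.single_apply, prod_univ_sum,
    Fintype.piFinset_univ, Fintype.prod_ite_zero, prod_const_one, funext_iff]
  exact sum_congr rfl fun z _ => if_congr forall_comm rfl rfl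

theorem ghz_eq_smul_unitTensor :
    ghz N = ((Real.sqrt 2 : ℝ) : ℂ)⁻¹ • unitTensor N (Fin 2) := by
  simp only [ghz, unitTensor, Fin.sum_univ_two]

theorem transforms_smul_left_iff [Fintype κ] {ψ : State N κ} {φ : State N κ'} {c : ℂ}
    (hc : c ≠ 0) : Transforms (c • ψ) φ ↔ Transforms ψ φ := by
  have happly (A : Fin N → Matrix κ' κ ℂ) : applyLocal A (c • ψ) = c • applyLocal A ψ := by
    funext y
    simp only [applyLocal, Pi.smul_apply, smul_eq_mul, mul_sum, mul_left_comm]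
  constructor
  · rintro ⟨A, b, hb, hA⟩
    refine ⟨A, c⁻¹ * b, mul_ne_zero (inv_ne_zero hc) hb, ?_⟩
    rw [mul_smul, ← hA, happly, inv_smul_smul₀ hc]
  · rintro ⟨A, b, hb, hA⟩
    exact ⟨A, c * b, mul_ne_zero hc hb, by rw [happly, hA, mul_smul]⟩

theorem transforms_copies_ghz_iff (hN : 0 < N) {m : ℕ} {φ : State N κ} :
    Transforms (copies (ghz N) m) φ ↔ TensorRankLE φ (2 ^ m) := by
  have hsqrt : ((Real.sqrt 2 : ℝ) : ℂ)⁻¹ ≠ 0 := by simp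
  rw [ghz_eq_smul_unitTensor, copies_smul, copies_unitTensor,
    transforms_smul_left_iff (pow_ne_zero m hsqrt), transforms_unitTensor_iff hN]
  simp

/-! ### Tensor rank of sum indicators -/

/-- The indicator of the words `x` whose letters have total weight `a` under `f`. -/
def sumIndicator {M : Type*} [AddCommMonoid M] [DecidableEq M] (f : κ → M) (a : M) : State N κ :=
  fun x => if ∑ i, f (x i) = a then 1 else 0

theorem addChar_sum {T G : Type*} [AddCommGroup G] (χ : AddChar G ℂ) (s : Finset T) (f : T → G) :
    χ (∑ t ∈ s, f t) = ∏ t ∈ s, χ (f t) :=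
  map_prod χ.toMonoidHom (fun t => Multiplicative.ofAdd (f t)) s

/- Expand the indicator in the characters of `G`: each of them is multiplicative, hence a product
state. -/
theorem tensorRankLE_sumIndicator_card {G : Type*} [AddCommGroup G] [Fintype G] [DecidableEq G]
    (f : κ → G) (a : G) : TensorRankLE (sumIndicator f a : State N κ) (Fintype.card G) := by
  refine .of_card_le (T := AddChar G ℂ) AddChar.card_eq.le
    (w := fun χ => (Fintype.card G : ℂ)⁻¹ * χ (-a)) (v := fun χ _ z => χ (f z)) ?_
  funext x
  have hG : (Fintype.card G : ℂ) ≠ 0 := Nat.cast_ne_zero.2 Fintype.card_ne_zero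
  have horth := AddChar.sum_apply_eq_ite (∑ i, f (x i) - a)
  simp only [sub_eq_neg_add, AddChar.map_add_eq_mul, addChar_sum] at horth
  simp only [Finset.sum_apply, Pi.smul_apply, productState, smul_eq_mul, mul_assoc, ← mul_sum,
    horth, sumIndicator, neg_add_eq_zero, eq_comm (a := a)]
  split_ifs <;> simp [hG]

theorem card_piAntidiag_univ (hN : 0 < N) (n : ℕ) :
    #(piAntidiag (univ : Finset (Fin N)) n) = (n + (N - 1)).choose (N - 1) := by
  have hcard : #(piAntidiag (univ : Finset (Fin N)) n) = #(finsuppAntidiag univ n) :=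
    (card_equiv Finsupp.equivFunOnFinite fun f => by simp).symm
  rw [hcard, card_finsuppAntidiag_nat_eq_choose, card_univ, Fintype.card_fin, ← Nat.choose_symm_add]
  congr 1
  omega

theorem tensorRankLE_sumIndicator_choose (hN : 0 < N) (f : κ → ℕ) (a : ℕ) :
    TensorRankLE (sumIndicator f a : State N κ) ((a + (N - 1)).choose (N - 1)) := by
  refine .of_card_le (T := piAntidiag (univ : Finset (Fin N)) a)
    (by rw [Fintype.card_coe, card_piAntidiag_univ hN]) (w := 1)
    (v := fun b i z => if f z = b.1 i then 1 else 0) ?_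
  funext x
  simp only [sumIndicator, Pi.one_apply, one_smul, Finset.sum_apply, productState,
    Fintype.prod_ite_zero, prod_const_one, ← funext_iff]
  rw [sum_coe_sort (piAntidiag univ a) fun b => if (fun i => f (x i)) = b then (1 : ℂ) else 0,
    sum_ite_eq]
  simp

theorem forall_eq_iff_forall_zmod_eq_and_sum_eq {T : Type*} [Fintype T] (r : T → ℕ) (s : ℕ) :
    (∀ t, r t = s) ↔ ∑ t, r t = Fintype.card T * s ∧ ∀ t, (r t : ZMod (s + 1)) = s := by
  refine ⟨fun h => by simp [h], fun ⟨hsum, hmod⟩ t => ?_⟩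
  have hle : ∀ t ∈ univ, s ≤ r t := fun t _ => by
    have := (ZMod.natCast_eq_natCast_iff' _ _ _).1 (hmod t)
    rw [Nat.mod_eq_of_lt s.lt_succ_self] at this
    exact this.symm.trans_le (Nat.mod_le _ _)
  exact ((sum_eq_sum_iff_of_le hle).1 (by simp [hsum]) t (mem_univ t)).symm

/- Every copy has weight `s` iff every copy has weight `s` modulo `s + 1`, hence at least `s`, and
the total weight of all copies is `n * s`. -/
theorem copies_sumIndicator_eq_mul_prod (f : κ → ℕ) (s n : ℕ) :
    (copies (sumIndicator f s) n : State N (Fin n → κ)) =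
      sumIndicator (fun z => ∑ c, f (z c)) (n * s) *
        ∏ c, sumIndicator (fun z => (f (z c) : ZMod (s + 1))) s := by
  funext y
  have hsplit := forall_eq_iff_forall_zmod_eq_and_sum_eq (fun c => ∑ i, f (y i c)) s
  simp only [Fintype.card_fin, sum_comm (s := (univ : Finset (Fin n))), Nat.cast_sum] at hsplit
  simp only [copies, sumIndicator, Pi.mul_apply, Finset.prod_apply, Fintype.prod_ite_zero,
    prod_const_one, hsplit, ite_and, ite_mul, one_mul, zero_mul]

theorem tensorRankLE_copies_sumIndicator (hN : 0 < N) (f : κ → ℕ) (s n : ℕ) :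
    TensorRankLE (copies (sumIndicator f s) n : State N (Fin n → κ))
      ((n * s + (N - 1)).choose (N - 1) * (s + 1) ^ n) := by
  rw [copies_sumIndicator_eq_mul_prod]
  refine (tensorRankLE_sumIndicator_choose hN _ _).mul ?_
  simpa [ZMod.card] using TensorRankLE.prod univ fun c _ =>
    tensorRankLE_sumIndicator_card (N := N) (fun z : Fin n → κ => (f (z c) : ZMod (s + 1))) s

/-! ### Letter counts and Dicke states -/

section LetterCount

variable {α : Type*} [DecidableEq κ]

/-- The number of occurrences of each letter in the word `x`, restricted to the positions in `S`;
for `S = univ` this is the type of `x` in the sense of information theory. -/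
def letterCount (S : Finset α) (x : α → κ) : κ → ℕ := fun k => #{i ∈ S | x i = k}

theorem sum_letterCount [Fintype κ] (S : Finset α) (x : α → κ) : ∑ k, letterCount S x k = #S :=
  (card_eq_sum_card_fiberwise fun _ _ => mem_univ _).symm

theorem letterCount_fst_equiv_sigma [Fintype α] {a : κ → ℕ} (e : α ≃ Σ k, Fin (a k)) :
    letterCount univ (fun i => (e i).1) = a := by
  funext k
  rw [letterCount, ← Fintype.card_subtype, ← Fintype.card_fin (a k)]
  exact Fintype.card_congr
    ((e.subtypeEquiv (q := fun s => s.1 = k) fun _ => Iff.rfl).trans (Equiv.sigmaSubtype k))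

theorem exists_letterCount_eq [Fintype κ] [Nonempty κ] {S : Finset α} {a : κ → ℕ}
    (ha : ∑ k, a k = #S) : ∃ x : α → κ, letterCount S x = a := by
  classical
  let e : S ≃ Σ k, Fin (a k) := Fintype.equivOfCardEq (by simp [ha])
  let x : α → κ := Function.extend Subtype.val (fun i => (e i).1) fun _ => Classical.arbitrary κ
  have hx (i : S) : x i = (e i).1 := Subtype.val_injective.extend_apply _ _ i
  have hrestrict : letterCount S x = letterCount univ fun i => (e i).1 := by
    funext k
    simp only [letterCount, card_filter, ← hx]
    exact (sum_coe_sort S fun i => if x i = k then 1 else 0).symm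
  exact ⟨x, hrestrict.trans (letterCount_fst_equiv_sigma e)⟩

theorem letterCount_univ_piecewise [Fintype α] [DecidableEq α] (S : Finset α) (x y : α → κ) :
    letterCount univ (S.piecewise x y) = letterCount S x + letterCount Sᶜ y := by
  funext k
  simp only [letterCount, card_filter, Pi.add_apply]
  rw [← sum_add_sum_compl S]
  congr 1 <;> refine sum_congr rfl fun i hi => ?_
  · rw [piecewise_eq_of_mem _ _ _ hi]
  · rw [piecewise_eq_of_notMem _ _ _ (mem_compl.1 hi)]

theorem letterCount_comp_equiv {β : Type*} [Fintype α] [Fintype β] (x : α → κ) (σ : β ≃ α) :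
    letterCount univ (x ∘ σ) = letterCount univ x :=
  funext fun k => card_equiv σ fun i => by simp

theorem exists_comp_perm_eq_iff [Fintype α] {x y : α → κ} :
    (∃ σ : Equiv.Perm α, x ∘ σ = y) ↔ letterCount univ x = letterCount univ y := by
  constructor
  · rintro ⟨σ, rfl⟩
    exact (letterCount_comp_equiv x σ).symm
  · intro h
    have e (k : κ) : Nonempty ({i // y i = k} ≃ {i // x i = k}) := Fintype.card_eq.1 <| by
      simpa only [Fintype.card_subtype, letterCount] using (congrFun h k).symm
    exact ⟨Equiv.ofFiberEquiv fun k => (e k).some, funext (Equiv.ofFiberEquiv_map _)⟩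

end LetterCount

/-- The unnormalized Dicke state: the sum of the product basis states in which every letter `k`
occurs `j k` times. -/
def typeIndicator [Fintype κ] [DecidableEq κ] (j : κ → ℕ) : State N κ :=
  fun x => if letterCount univ x = j then 1 else 0

-- The sum over permutations counts a coset of the stabilizer of the word `w`.
theorem exists_symProj_ket_eq_smul [Fintype κ] [DecidableEq κ] (w : Fin N → κ) :
    ∃ C : ℂ, C ≠ 0 ∧ symProj (ket w) = C • typeIndicator (letterCount univ w) := by
  let stab : Finset (Equiv.Perm (Fin N)) := {ρ | w ∘ ρ = w}
  have hstab : #stab ≠ 0 := card_ne_zero_of_mem (a := 1) (by simp [stab])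
  refine ⟨(N.factorial : ℂ)⁻¹ * #stab, mul_ne_zero
    (inv_ne_zero (Nat.cast_ne_zero.2 N.factorial_ne_zero)) (Nat.cast_ne_zero.2 hstab), ?_⟩
  funext x
  have hsum : symProj (ket w) x = (N.factorial : ℂ)⁻¹ * #{π : Equiv.Perm (Fin N) | x ∘ π = w} := by
    simp only [symProj, ket, Pi.single_apply, sum_boole]
    rfl
  rw [hsum, Pi.smul_apply, smul_eq_mul, mul_assoc, typeIndicator]
  split_ifs with hx
  · obtain ⟨σ, hσ⟩ := exists_comp_perm_eq_iff.2 hx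
    have hcoset : #stab = #{π : Equiv.Perm (Fin N) | x ∘ π = w} :=
      card_equiv (Equiv.mulLeft σ) fun ρ => by
        simp [stab, Equiv.Perm.coe_mul, ← Function.comp_assoc, hσ]
    rw [← hcoset, mul_one]
  · rw [filter_eq_empty_iff.2 fun π _ hπ => hx (exists_comp_perm_eq_iff.1 ⟨π, hπ⟩)]
    simp

theorem exists_dicke_eq_smul_typeIndicator {d : ℕ} (j : Fin d → ℕ) :
    ∃ C : ℂ, C ≠ 0 ∧ dicke j = C • typeIndicator j := by
  obtain ⟨C, hC, hsymm⟩ := exists_symProj_ket_eq_smul (blockWord j)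
  have hcount : letterCount univ (blockWord j) = j :=
    letterCount_fst_equiv_sigma finSigmaFinEquiv.symm
  have hnorm : ((Real.sqrt (Nat.multinomial univ j) : ℝ) : ℂ) ≠ 0 := by
    rw [Complex.ofReal_ne_zero, Real.sqrt_ne_zero (Nat.cast_nonneg _), Nat.cast_ne_zero]
    exact (Nat.multinomial_pos univ j).ne'
  exact ⟨_, mul_ne_zero hnorm hC, by rw [dicke, hsymm, hcount, smul_smul]⟩

theorem tensorRankLE_copies_dicke_iff {d : ℕ} (j : Fin d → ℕ) {n r : ℕ} :
    TensorRankLE (copies (dicke j) n) r ↔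
      TensorRankLE (copies (typeIndicator j : State (∑ i, j i) (Fin d)) n) r := by
  obtain ⟨C, hC, hdicke⟩ := exists_dicke_eq_smul_typeIndicator j
  rw [hdicke, copies_smul, tensorRankLE_smul_iff (pow_ne_zero n hC)]

/-! ### The upper bound on the tensor rank of Dicke states -/

theorem copies_prod {T : Type*} (s : Finset T) (φ : T → State N κ) (n : ℕ) :
    copies (∏ t ∈ s, φ t) n = ∏ t ∈ s, copies (φ t) n := by
  funext x
  simp only [copies, Finset.prod_apply]
  exact prod_comm

theorem eq_iff_forall_ne_of_sum_eq [Fintype κ] {a b : κ → ℕ} (h : ∑ k, a k = ∑ k, b k) (o : κ) :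
    a = b ↔ ∀ k ≠ o, a k = b k := by
  classical
  refine ⟨fun hab k _ => congrFun hab k, fun hne => funext fun k => ?_⟩
  have hcompl : ∑ k ∈ {o}ᶜ, a k = ∑ k ∈ {o}ᶜ, b k :=
    sum_congr rfl fun k hk => hne k (by simpa using hk)
  rw [Fintype.sum_eq_add_sum_compl o, Fintype.sum_eq_add_sum_compl o b, hcompl] at h
  obtain rfl | hk := eq_or_ne k o
  · exact Nat.add_right_cancel h
  · exact hne k hk

theorem typeIndicator_eq_prod_sumIndicator [Fintype κ] [DecidableEq κ] {j : κ → ℕ}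
    (hj : ∑ k, j k = N) (o : κ) :
    (typeIndicator j : State N κ) =
      ∏ k ∈ {o}ᶜ, sumIndicator (fun z => if z = k then 1 else 0) (j k) := by
  funext x
  have hx : letterCount univ x = j ↔ ∀ k ∈ ({o}ᶜ : Finset κ), letterCount univ x k = j k := by
    simpa using eq_iff_forall_ne_of_sum_eq ((sum_letterCount univ x).trans (by simp [hj])) o
  simp only [Finset.prod_apply, sumIndicator, prod_boole, ← card_filter]
  simp only [typeIndicator, hx]
  congr

theorem tensorRankLE_copies_typeIndicator [Fintype κ] [DecidableEq κ] (hN : 0 < N) {j : κ → ℕ}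
    (hj : ∑ k, j k = N) (o : κ) (n : ℕ) :
    TensorRankLE (copies (typeIndicator j : State N κ) n)
      (∏ k ∈ {o}ᶜ, ((n * j k + (N - 1)).choose (N - 1) * (j k + 1) ^ n)) := by
  rw [typeIndicator_eq_prod_sumIndicator hj o, copies_prod]
  exact .prod _ fun k _ => tensorRankLE_copies_sumIndicator hN _ (j k) n

/-! ### The flattening lower bound -/

/-- The submatrix of the flattening of `φ` along the bipartition `S ∪ Sᶜ` of the parties with rows
`u` (only read on `S`) and columns `v` (only read on `Sᶜ`). -/
def flattening {T T' : Type*} (φ : State N κ) (S : Finset (Fin N)) (u : T → Fin N → κ)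
    (v : T' → Fin N → κ) : Matrix T T' ℂ :=
  .of fun a b => φ (S.piecewise (u a) (v b))

theorem TensorRankLE.rank_flattening_le {T T' : Type*} [Fintype T'] {φ : State N κ} {r : ℕ}
    (h : TensorRankLE φ r) (S : Finset (Fin N)) (u : T → Fin N → κ) (v : T' → Fin N → κ) :
    (flattening φ S u v).rank ≤ r := by
  obtain ⟨w, p, rfl⟩ := h
  let L : Matrix T (Fin r) ℂ := .of fun a t => w t * ∏ i ∈ S, p t i (u a i)
  let R : Matrix (Fin r) T' ℂ := .of fun t b => ∏ i ∈ Sᶜ, p t i (v b i)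
  have hLR : flattening (∑ t, w t • productState (p t)) S u v = L * R := by
    ext a b
    simp only [flattening, L, R, Matrix.of_apply, Matrix.mul_apply, Finset.sum_apply,
      Pi.smul_apply, smul_eq_mul, productState, mul_assoc]
    refine sum_congr rfl fun t _ => congrArg _ ?_
    rw [← prod_mul_prod_compl S]
    congr 1 <;> refine prod_congr rfl fun i hi => ?_
    · rw [piecewise_eq_of_mem _ _ _ hi]
    · rw [piecewise_eq_of_notMem _ _ _ (mem_compl.1 hi)]
  calc (flattening _ S u v).rank ≤ L.rank := hLR ▸ Matrix.rank_mul_le_left L R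
    _ ≤ r := by simpa only [Fintype.card_fin] using L.rank_le_card_width

theorem flattening_copies_eq_one {T : Type*} [DecidableEq T] {φ : State N κ}
    {S : Finset (Fin N)} {u v : T → Fin N → κ} (h : flattening φ S u v = 1) (n : ℕ) :
    flattening (copies φ n) S (fun (a : Fin n → T) i c => u (a c) i)
      (fun (b : Fin n → T) i c => v (b c) i) = 1 := by
  ext a b
  have hentry (c : Fin n) : φ (fun i => S.piecewise (fun i c => u (a c) i)
      (fun i c => v (b c) i) i c) = if a c = b c then 1 else 0 := by
    rw [← Matrix.one_apply, ← h, flattening, Matrix.of_apply]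
    congr 1
    funext i
    by_cases hi : i ∈ S <;> simp [hi]
  simp only [flattening, Matrix.of_apply, copies, hentry, Fintype.prod_ite_zero, prod_const_one,
    Matrix.one_apply, funext_iff]

theorem TensorRankLE.card_pow_le_of_flattening_eq_one {T : Type*} [Fintype T] [DecidableEq T]
    {φ : State N κ} {n r : ℕ} (h : TensorRankLE (copies φ n) r) {S : Finset (Fin N)}
    {u v : T → Fin N → κ} (huv : flattening φ S u v = 1) : Fintype.card T ^ n ≤ r := by
  have hrank := h.rank_flattening_le S (fun (a : Fin n → T) i c => u (a c) i)
    fun (b : Fin n → T) i c => v (b c) i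
  rw [flattening_copies_eq_one huv n, Matrix.rank_one] at hrank
  simpa only [Fintype.card_pi_const] using hrank

/- Rows: words on `S` with letter counts `a`; columns: words on `Sᶜ` with letter counts `j - b`.
Together they have letter counts `j` iff `a = b`. -/
theorem exists_flattening_typeIndicator_eq_one [Fintype κ] [DecidableEq κ] [Nonempty κ]
    {j : κ → ℕ} (hj : ∑ k, j k = N) (S : Finset (Fin N)) :
    ∃ u v : {a ∈ Iic j | ∑ k, a k = #S} → Fin N → κ, flattening (typeIndicator j) S u v = 1 := by
  have hmem (a : {a ∈ Iic j | ∑ k, a k = #S}) : a.1 ≤ j ∧ ∑ k, a.1 k = #S := by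
    simpa using mem_filter.1 a.2
  have hcompl (a : {a ∈ Iic j | ∑ k, a k = #S}) : ∑ k, (j - a.1) k = #Sᶜ := by
    simp only [Pi.sub_apply]
    rw [sum_tsub_distrib _ fun k _ => (hmem a).1 k, hj, (hmem a).2, card_compl, Fintype.card_fin]
  choose u hu using fun a => exists_letterCount_eq (hmem a).2
  choose v hv using fun b => exists_letterCount_eq (hcompl b)
  refine ⟨u, v, ?_⟩
  ext a b
  have hab : a.1 + (j - b.1) = j ↔ a = b := by
    calc a.1 + (j - b.1) = j ↔ a.1 + (j - b.1) = b.1 + (j - b.1) := by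
          rw [add_tsub_cancel_of_le (hmem b).1]
      _ ↔ a.1 = b.1 := add_left_inj _
      _ ↔ a = b := Subtype.ext_iff.symm
  simp only [flattening, Matrix.of_apply, typeIndicator, letterCount_univ_piecewise, hu, hv, hab,
    Matrix.one_apply]

theorem TensorRankLE.card_filter_Iic_pow_le [Fintype κ] [DecidableEq κ] [Nonempty κ] {j : κ → ℕ}
    (hj : ∑ k, j k = N) {n r : ℕ} (h : TensorRankLE (copies (typeIndicator j : State N κ) n) r)
    {s : ℕ} (hs : s ≤ N) : #{a ∈ Iic j | ∑ k, a k = s} ^ n ≤ r := by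
  obtain ⟨S, -, rfl⟩ := exists_subset_card_eq (s := (univ : Finset (Fin N))) (by simpa using hs)
  obtain ⟨u, v, huv⟩ := exists_flattening_typeIndicator_eq_one hj S
  simpa only [Fintype.card_coe] using h.card_pow_le_of_flattening_eq_one huv

theorem prod_compl_le_card_filter_Iic [Fintype κ] [DecidableEq κ] {j : κ → ℕ} {o : κ}
    (ho : ∑ k ∈ {o}ᶜ, j k ≤ j o) :
    ∏ k ∈ {o}ᶜ, (j k + 1) ≤ #{a ∈ Iic j | ∑ k, a k = ∑ k ∈ {o}ᶜ, j k} := by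
  have hcard : ∏ k ∈ {o}ᶜ, (j k + 1) = #(Iic (Function.update j o 0)) := by
    rw [Pi.card_Iic, Fintype.prod_eq_mul_prod_compl o, Function.update_self, Nat.card_Iic, zero_add,
      one_mul]
    refine prod_congr rfl fun k hk => ?_
    rw [Function.update_of_ne (by simpa using hk), Nat.card_Iic]
  rw [hcard]
  have hle {b : κ → ℕ} (hb : b ∈ (Iic (Function.update j o 0) : Finset _)) :
      b o = 0 ∧ ∀ k ≠ o, b k ≤ j k := by
    simpa [le_update_iff] using hb
  -- The letter `o` makes up the difference to the required sum.
  let fill (b : κ → ℕ) : κ → ℕ := Function.update b o (∑ k ∈ {o}ᶜ, j k - ∑ k ∈ {o}ᶜ, b k)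
  have hfill (b : κ → ℕ) {k : κ} (hk : k ≠ o) : fill b k = b k := Function.update_of_ne hk _ b
  refine card_le_card_of_injOn fill (fun b hb => ?_) fun b hb b' hb' h => ?_
  · have hsum : ∑ k ∈ {o}ᶜ, b k ≤ ∑ k ∈ {o}ᶜ, j k :=
      sum_le_sum fun k hk => (hle hb).2 k (by simpa using hk)
    refine mem_coe.2 (mem_filter.2 ⟨mem_Iic.2 (update_le_iff.2
      ⟨(Nat.sub_le _ _).trans ho, (hle hb).2⟩), ?_⟩)
    rw [Fintype.sum_eq_add_sum_compl o, sum_congr rfl fun k hk => hfill b (by simpa using hk)]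
    exact (congrArg (· + _) (Function.update_self ..)).trans (Nat.sub_add_cancel hsum)
  · funext k
    obtain rfl | hk := eq_or_ne k o
    · rw [(hle hb).1, (hle hb').1]
    · rw [← hfill b hk, h, hfill b' hk]

/-! ### Rates -/

theorem logb_two_natCast_nonneg (n : ℕ) : 0 ≤ Real.logb 2 n :=
  div_nonneg (Real.log_natCast_nonneg n) (Real.log_nonneg one_le_two)

theorem inv_ofReal_le_rate [Fintype κ] {ψ : State N κ} {φ : State N κ'} {P : ℕ → ℕ} {L : ℝ}
    (hP : Tendsto (fun n : ℕ => Real.logb 2 (P n) / n) atTop (𝓝 L))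
    (h : ∀ m n, P n ≤ 2 ^ m → Transforms (copies ψ m) (copies φ n)) :
    (ENNReal.ofReal L)⁻¹ ≤ rate ψ φ := by
  have hlim : Tendsto (fun n : ℕ => Real.logb 2 (P n) / n + 2 / n) atTop (𝓝 L) := by
    simpa using hP.add (tendsto_const_div_atTop_nhds_zero_nat (2 : ℝ))
  refine le_of_tendsto ((ENNReal.tendsto_ofReal hlim).inv) ?_
  filter_upwards [eventually_gt_atTop 0] with n hn
  -- The successor makes the number of copies of `ψ` positive even when `P n = 1`.
  let m := Nat.clog 2 (P n) + 1
  have hm : P n ≤ 2 ^ m :=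
    (Nat.le_pow_clog one_lt_two _).trans (Nat.pow_le_pow_right two_pos (Nat.le_succ _))
  have hclog : (m : ℝ) ≤ Real.logb 2 (P n) + 2 := by
    have hceil := (Nat.ceil_lt_add_one (logb_two_natCast_nonneg (P n))).le
    rw [← Nat.cast_two, Real.natCeil_logb_natCast, Nat.cast_two] at hceil
    simp only [m, Nat.cast_succ]
    linarith
  calc (ENNReal.ofReal (Real.logb 2 (P n) / n + 2 / n))⁻¹
      ≤ (ENNReal.ofReal (m / n))⁻¹ := by
        rw [← add_div]
        gcongr
    _ = n / m := by
        rw [ENNReal.ofReal_div_of_pos (Nat.cast_pos.2 hn), ENNReal.ofReal_natCast,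
          ENNReal.ofReal_natCast, ENNReal.inv_div (.inl (ENNReal.natCast_ne_top n))
            (.inl (Nat.cast_ne_zero.2 hn.ne'))]
    _ ≤ rate ψ φ := le_sSup ⟨n, m, Nat.succ_pos _, h m n hm, rfl⟩

theorem rate_le_inv_ofReal_logb [Fintype κ] {ψ : State N κ} {φ : State N κ'} {P : ℕ} (hP : 0 < P)
    (h : ∀ m n, Transforms (copies ψ n) (copies φ m) → P ^ m ≤ 2 ^ n) :
    rate ψ φ ≤ (ENNReal.ofReal (Real.logb 2 P))⁻¹ := by
  refine sSup_le ?_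
  rintro _ ⟨m, n, -, hT, rfl⟩
  have hlog : m * Real.logb 2 P ≤ n := by
    have hpow : (P : ℝ) ^ m ≤ 2 ^ n := by exact_mod_cast h m n hT
    simpa [Real.logb_pow] using Real.logb_le_logb_of_le one_lt_two (by positivity) hpow
  rw [ENNReal.le_inv_iff_mul_le, ENNReal.mul_comm_div, ← mul_div_assoc]
  refine ENNReal.div_le_of_le_mul ?_
  rw [one_mul, ← ENNReal.ofReal_natCast, ← ENNReal.ofReal_natCast n,
    ← ENNReal.ofReal_mul (Nat.cast_nonneg _)]
  exact ENNReal.ofReal_le_ofReal hlog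

theorem tendsto_logb_choose_div (a r : ℕ) :
    Tendsto (fun n : ℕ => Real.logb 2 ((n * a + r).choose r) / n) atTop (𝓝 0) := by
  have hc : (0 : ℝ) < a + r + 1 := by positivity
  have hlog : Tendsto (fun n : ℕ => Real.log (n * (a + r + 1)) / (n * (a + r + 1))) atTop (𝓝 0) :=
    Real.isLittleO_log_id_atTop.tendsto_div_nhds_zero.comp
      (tendsto_natCast_atTop_atTop.atTop_mul_const hc)
  have hbound := hlog.const_mul (r * (a + r + 1) / Real.log 2)
  rw [mul_zero] at hbound
  refine squeeze_zero' (.of_forall fun n => ?_) ?_ hbound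
  · exact div_nonneg (logb_two_natCast_nonneg _) n.cast_nonneg
  · filter_upwards [eventually_gt_atTop 0] with n hn
    have hpow : ((n * a + r).choose r : ℝ) ≤ (n * (a + r + 1)) ^ r := by
      have hbase : n * a + r ≤ n * (a + r + 1) := by nlinarith
      exact_mod_cast (Nat.choose_le_pow _ _).trans (Nat.pow_le_pow_left hbase r)
    have hchoose : (0 : ℝ) < (n * a + r).choose r :=
      Nat.cast_pos.2 (Nat.choose_pos (Nat.le_add_left _ _))
    calc Real.logb 2 ((n * a + r).choose r) / n
        ≤ Real.logb 2 ((n * (a + r + 1)) ^ r) / n := by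
          gcongr
          exact one_lt_two
      _ = r * (a + r + 1) / Real.log 2 * (Real.log (n * (a + r + 1)) / (n * (a + r + 1))) := by
          rw [Real.logb_pow, Real.logb]
          field_simp

theorem tendsto_logb_prod_choose_mul_pow_div (s : Finset κ) (j : κ → ℕ) (r : ℕ) :
    Tendsto (fun n : ℕ => Real.logb 2
      ((∏ k ∈ s, ((n * j k + r).choose r * (j k + 1) ^ n) : ℕ) : ℝ) / n) atTop
      (𝓝 (∑ k ∈ s, Real.logb 2 ((j k : ℝ) + 1))) := by
  have hlim := tendsto_finsetSum s fun k _ =>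
    (tendsto_logb_choose_div (j k) r).add_const (Real.logb 2 ((j k : ℝ) + 1))
  simp only [zero_add] at hlim
  refine hlim.congr' ?_
  filter_upwards [eventually_gt_atTop 0] with n hn
  have hchoose (k : κ) : ((n * j k + r).choose r : ℝ) ≠ 0 :=
    Nat.cast_ne_zero.2 (Nat.choose_pos (Nat.le_add_left _ _)).ne'
  push_cast
  rw [Real.logb_prod _ _ fun k _ => mul_ne_zero (hchoose k) (by positivity), sum_div]
  refine sum_congr rfl fun k _ => ?_
  rw [Real.logb_mul (hchoose k) (by positivity), Real.logb_pow, add_div,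
    mul_div_cancel_left₀ _ (Nat.cast_ne_zero.2 hn.ne')]

theorem transforms_copies_dicke {d : ℕ} (j : Fin d → ℕ) (o : Fin d) (hN : 0 < ∑ i, j i) (m n : ℕ)
    (h : ∏ k ∈ {o}ᶜ, ((n * j k + ((∑ i, j i) - 1)).choose ((∑ i, j i) - 1) * (j k + 1) ^ n)
      ≤ 2 ^ m) :
    Transforms (copies (ghz (∑ i, j i)) m) (copies (dicke j) n) := by
  rw [transforms_copies_ghz_iff hN, tensorRankLE_copies_dicke_iff]
  exact (tensorRankLE_copies_typeIndicator hN rfl o n).mono h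

theorem rate_ghz_dicke_le {d : ℕ} {j : Fin d → ℕ} {o : Fin d} (ho : ∑ k ∈ {o}ᶜ, j k ≤ j o)
    (hN : 0 < ∑ i, j i) :
    rate (ghz (∑ i, j i)) (dicke j) ≤
      (ENNReal.ofReal (∑ k ∈ {o}ᶜ, Real.logb 2 ((j k : ℝ) + 1)))⁻¹ := by
  have hlog : Real.logb 2 ((∏ k ∈ {o}ᶜ, (j k + 1) : ℕ) : ℝ) =
      ∑ k ∈ {o}ᶜ, Real.logb 2 ((j k : ℝ) + 1) := by
    push_cast
    exact Real.logb_prod _ _ fun k _ => by positivity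
  rw [← hlog]
  refine rate_le_inv_ofReal_logb (prod_pos fun k _ => Nat.succ_pos _) fun m n hT => ?_
  rw [transforms_copies_ghz_iff hN, tensorRankLE_copies_dicke_iff] at hT
  have : Nonempty (Fin d) := ⟨o⟩
  exact (Nat.pow_le_pow_left (prod_compl_le_card_filter_Iic ho) m).trans
    (hT.card_filter_Iic_pow_le rfl (sum_le_univ_sum_of_nonneg fun k => (j k).zero_le))

end SLOCC

theorem theorem2_general {d : ℕ} (j : Fin d → ℕ) (o : Fin d) (hN : 0 < ∑ i, j i) :
    (ENNReal.ofReal (∑ k ∈ {o}ᶜ, Real.logb 2 ((j k : ℝ) + 1)))⁻¹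
        ≤ SLOCC.rate (SLOCC.ghz (∑ i, j i)) (SLOCC.dicke j) ∧
    (∀ m n : ℕ,
      ∏ k ∈ {o}ᶜ, ((n * j k + ((∑ i, j i) - 1)).choose ((∑ i, j i) - 1) * (j k + 1) ^ n) ≤ 2 ^ m →
      SLOCC.Transforms (SLOCC.copies (SLOCC.ghz (∑ i, j i)) m)
        (SLOCC.copies (SLOCC.dicke j) n)) ∧
    (∑ k ∈ {o}ᶜ, j k ≤ j o →
      SLOCC.rate (SLOCC.ghz (∑ i, j i)) (SLOCC.dicke j)
        = (ENNReal.ofReal (∑ k ∈ {o}ᶜ, Real.logb 2 ((j k : ℝ) + 1)))⁻¹) := by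
  have hT (m n : ℕ) : _ → SLOCC.Transforms _ _ := SLOCC.transforms_copies_dicke j o hN m n
  have hlower := SLOCC.inv_ofReal_le_rate
    (SLOCC.tendsto_logb_prod_choose_mul_pow_div {o}ᶜ j ((∑ i, j i) - 1)) hT
  exact ⟨hlower, hT, fun ho => (SLOCC.rate_ghz_dicke_le ho hN).antisymm hlower⟩

theorem theorem2 (d : ℕ) (j : Fin (d + 1) → ℕ) (hj : Antitone j) (hpos : ∀ i, 1 ≤ j i) :
    (ENNReal.ofReal (∑ i : Fin d, Real.logb 2 ((j i.succ : ℝ) + 1)))⁻¹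
        ≤ SLOCC.rate (SLOCC.ghz (∑ i, j i)) (SLOCC.dicke j) ∧
    (∀ m n : ℕ,
      ∏ k : Fin d, ((n * j k.succ + ((∑ i, j i) - 1)).choose ((∑ i, j i) - 1)
          * (j k.succ + 1) ^ n) ≤ 2 ^ m →
      SLOCC.Transforms (SLOCC.copies (SLOCC.ghz (∑ i, j i)) m)
        (SLOCC.copies (SLOCC.dicke j) n)) ∧
    (∑ i : Fin d, j i.succ ≤ j 0 →
      SLOCC.rate (SLOCC.ghz (∑ i, j i)) (SLOCC.dicke j)
        = (ENNReal.ofReal (∑ i : Fin d, Real.logb 2 ((j i.succ : ℝ) + 1)))⁻¹) := by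
  simpa only [← Fin.image_succ_univ, Finset.sum_image (Fin.succ_injective d).injOn,
    Finset.prod_image (Fin.succ_injective d).injOn] using
    theorem2_general j 0 (Finset.sum_pos (fun i _ => hpos i) Finset.univ_nonempty)
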